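/- Let $\mathbb{H}^3=\{(x,y,z)\in\mathbb{R}^3 : z>0\}$ carry the hyperbolic metric $g=\frac{1}{z^2}(dx^2+dy^2+dz^2)$, and let $\nabla$ be its Levi-Civita connection. Let $I\subseteq\mathbb{R}$ be an open interval and let $\alpha,\beta:I\to\mathbb{H}^3$ be smooth immersed curves. For $s\in I$ let $T(s)=\alpha'(s)/|\alpha'(s)|_g$ be the unit tangent vector of $\alpha$ (so $T=\alpha'$ when $\alpha$ has unit speed), and let $\gamma_{T(s)}:\mathbb{R}\to\mathbb{H}^3$ be the geodesic with $\gamma_{T(s)}(0)=\alpha(s)$ and $\gamma_{T(s)}'(0)=T(s)$; thus $(s,t)\mapsto\gamma_{T(s)}(t)$ parametrizes the tangential surface of $\alpha$. Assume that $\beta$ is an involute of $\alpha$ (and $\alpha$ an evolute of $\beta$), written as $\beta(s)=\gamma_{T(s)}(\lambda(s))$ with a function $\lambda:I\to\mathbb{R}$; that is, $\beta$ lies on the tangential surface in this way and meets the tangent geodesics of $\alpha$ orthogonally: $g\big(\beta'(s),\gamma_{T(s)}'(\lambda(s))\big)=0$ for all $s\in I$. Then $$N(s)=\gamma_{T(s)}'(\lambda(s)),\qquad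 s\in I,$$ is a rotation minimizing vector field along $\beta$: it is a smooth vector field along $\beta$, normal to $\beta$, and parallel with respect to the normal connection of $\beta$, i.e. the component of $\nabla_{\beta'(s)}N$ orthogonal to $\beta'(s)$ vanishes for every $s\in I$. -/

import Mathlib

open scoped ContDiff Matrix

noncomputable section

namespace Hyp3

/-- Coordinate vectors `(x, y, z)`; they serve both as points and as tangent vectors. -/
abbrev Vec : Type := Fin 3 → ℝ

/-- The underlying set `z > 0` of the upper half-space model of hyperbolic 3-space. -/
def halfSpace : Set Vec := {p | 0 < p 2}

/-- The matrix of the hyperbolic metric `(dx² + dy² + dz²) / z²` at the point `p`. -/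
def metric (p : Vec) : Matrix (Fin 3) (Fin 3) ℝ := (1 / p 2 ^ 2) • 1

/-- The hyperbolic inner product of two tangent vectors at `p`. -/
def g (p u v : Vec) : ℝ := u ⬝ᵥ (metric p *ᵥ v)

/-- The partial derivative `∂ g_{ij} / ∂ x_l` at `p`. -/
def dMetric (p : Vec) (l i j : Fin 3) : ℝ :=
  fderiv ℝ (fun q : Vec => metric q i j) p (Pi.single l 1)

/-- The Christoffel symbols `Γ^k_{ij}` of the Levi-Civita connection of the hyperbolic metric. -/
def christoffel (p : Vec) (k i j : Fin 3) : ℝ :=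
  (1 / 2) * ∑ l, (metric p)⁻¹ k l * (dMetric p i j l + dMetric p j i l - dMetric p l i j)

/-- The Levi-Civita covariant derivative `∇_{c'} V` of a vector field `V` along a curve `c`. -/
def covDeriv (c V : ℝ → Vec) (t : ℝ) : Vec := fun k =>
  deriv V t k + ∑ i, ∑ j, christoffel (c t) k i j * deriv c t i * V t j

/-- A complete geodesic `γ : ℝ → H³` with its affine parameter: `∇_{γ'} γ' = 0`. -/
structure IsGeodesic (γ : ℝ → Vec) : Prop where
  smooth : ContDiff ℝ ∞ γ
  mem : ∀ t, γ t ∈ halfSpace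
  eq_zero : ∀ t, covDeriv γ (deriv γ) t = 0

/-- A smooth immersed curve in `H³` parametrized by `I` (to be used for open intervals `I`). -/
structure IsImmersedCurve (I : Set ℝ) (c : ℝ → Vec) : Prop where
  smooth : ContDiffOn ℝ ∞ c I
  mem : ∀ s ∈ I, c s ∈ halfSpace
  deriv_ne_zero : ∀ s ∈ I, deriv c s ≠ 0

/-- The unit tangent vector `c' / |c'|`, where `|·|` is the hyperbolic norm. -/
def unitTangent (c : ℝ → Vec) (s : ℝ) : Vec :=
  (1 / Real.sqrt (g (c s) (deriv c s) (deriv c s))) • deriv c s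

/-- `(s, t) ↦ γ s t` parametrizes the tangential surface of `α`: each `γ s` is the tangent
geodesic of `α` at `α s`, with the unit tangent vector as initial velocity. -/
structure IsTangentialSurface (I : Set ℝ) (α : ℝ → Vec) (γ : ℝ → ℝ → Vec) : Prop where
  geodesic : ∀ s ∈ I, IsGeodesic (γ s)
  apply_zero : ∀ s ∈ I, γ s 0 = α s
  deriv_zero : ∀ s ∈ I, deriv (γ s) 0 = unitTangent α s

/-- The curve `β`, written as `β s = γ s (lam s)`, is an involute of the curve whose tangential
surface is parametrized by `γ`: it lies on that surface and is orthogonal to its rulings. -/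
structure IsInvolute (I : Set ℝ) (γ : ℝ → ℝ → Vec) (lam : ℝ → ℝ) (β : ℝ → Vec) : Prop where
  eq : ∀ s ∈ I, β s = γ s (lam s)
  orthogonal : ∀ s ∈ I, g (β s) (deriv β s) (deriv (γ s) (lam s)) = 0

/-- The covariant derivative of a normal field `N` along `c` in the normal bundle of `c`:
the component of `∇_{c'} N` that is orthogonal to `c'`. -/
def normalCovDeriv (c N : ℝ → Vec) (s : ℝ) : Vec :=
  covDeriv c N s -
    (g (c s) (covDeriv c N s) (deriv c s) / g (c s) (deriv c s) (deriv c s)) • deriv c s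

/-- `N` is a rotation minimizing vector field along the immersed curve `c`: a smooth normal
field which is parallel with respect to the normal connection. -/
structure IsRM (I : Set ℝ) (c N : ℝ → Vec) : Prop where
  smooth : ContDiffOn ℝ ∞ N I
  normal : ∀ s ∈ I, g (c s) (deriv c s) (N s) = 0
  parallel : ∀ s ∈ I, normalCovDeriv c N s = 0

end Hyp3

end

/-!
The half-space is mapped onto the hyperboloid `⟪X, X⟫ = -1` in Lorentzian 4-space, with light-cone
coordinates `Φ (x, y, z) = (1, x, y, x² + y² + z²) / z`. This map is isometric, and the Gauss formula
`(dΦ V)' = dΦ (∇_{c'} V) + g (c', V) Φ c` (`Hyp3.hasDerivAt_dToHyperboloid`) turns covariant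
derivatives into ordinary ones. A unit speed geodesic satisfies the linear equation `X'' = X`, so it is
`X t = cosh t • X 0 + sinh t • X' 0` (`Hyp3.IsGeodesic.toHyperboloid_eq`).

Write `A`, `B` for the images of `α`, `β`, and `U`, `M` for those of the unit tangent of `α` and of the
field `N`. Then `B = cosh λ A + sinh λ U` and `M = sinh λ A + cosh λ U`. Since `sinh λ = ⟪B, U⟫`, the
function `λ` is automatically smooth, and so is `N`. Put `a = |α'|`, so that `A' = a U`. The
orthogonality `⟪B', M⟫ = 0` amounts to `λ' = -a`, and then
`B' = sinh λ (U' - a A)` and `M' = cosh λ (U' - a A)`. As `B' ≠ 0`, this gives `sinh λ ≠ 0` and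
`M' = coth λ B'`, so by the Gauss formula `∇_{β'} N = coth λ β'` has no component orthogonal to `β'`.
-/

open scoped ContDiff Matrix

namespace Hyp3

/-! ### The metric and the covariant derivative in coordinates -/

lemma g_eq (p u v : Vec) : g p u v = (u 0 * v 0 + u 1 * v 1 + u 2 * v 2) / p 2 ^ 2 := by
  simp [g, metric, dotProduct, Matrix.smul_mulVec, Fin.sum_univ_three]
  ring

lemma g_self_pos {p v : Vec} (hp : p ∈ halfSpace) (hv : v ≠ 0) : 0 < g p v v := by
  have hz : 0 < p 2 := hp
  rw [g_eq]
  refine div_pos ?_ (by positivity)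
  by_contra h
  apply hv
  funext i
  fin_cases i <;> simp only [Fin.zero_eta, Fin.mk_one, Fin.reduceFinMk, Pi.zero_apply] <;>
    nlinarith [mul_self_nonneg (v 0), mul_self_nonneg (v 1), mul_self_nonneg (v 2)]

lemma g_smul_left (p u v : Vec) (k : ℝ) : g p (k • u) v = k * g p u v := by
  simp only [g_eq, Pi.smul_apply, smul_eq_mul]
  ring

lemma inv_metric {p : Vec} (hp : p ∈ halfSpace) : (metric p)⁻¹ = (p 2 ^ 2) • 1 := by
  have hz : p 2 ≠ 0 := ne_of_gt hp
  apply Matrix.inv_eq_right_inv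
  simp [metric, smul_smul, hz]

lemma dMetric_eq {p : Vec} (hp : p ∈ halfSpace) (l i j : Fin 3) :
    dMetric p l i j = if i = j ∧ l = 2 then -2 / p 2 ^ 3 else 0 := by
  have hz : p 2 ≠ 0 := ne_of_gt hp
  have h2 : HasFDerivAt (fun q : Vec => q 2) (ContinuousLinearMap.proj (R := ℝ) 2) p :=
    (ContinuousLinearMap.proj (R := ℝ) (φ := fun _ : Fin 3 => ℝ) 2).hasFDerivAt
  have h := (((hasDerivAt_id (p 2)).pow 2).inv (pow_ne_zero 2 hz)).comp_hasFDerivAt p h2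
  have h' := h.mul_const ((1 : Matrix (Fin 3) (Fin 3) ℝ) i j)
  have he : (fun q : Vec => metric q i j) =
      fun q : Vec => (q 2 ^ 2)⁻¹ * (1 : Matrix (Fin 3) (Fin 3) ℝ) i j := by
    funext q
    simp [metric]
  rw [dMetric, he, HasFDerivAt.fderiv (f := fun q : Vec =>
    (q 2 ^ 2)⁻¹ * (1 : Matrix (Fin 3) (Fin 3) ℝ) i j) h']
  by_cases hij : i = j <;> by_cases hl : l = 2
  · subst hij hl
    simp
    field_simp
  · simp [hl, eq_comm]
  · simp [hij]
  · simp [hij]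

lemma christoffel_eq {p : Vec} (hp : p ∈ halfSpace) (k i j : Fin 3) :
    christoffel p k i j = ((if i = j ∧ k = 2 then 1 else 0) - (if j = k ∧ i = 2 then 1 else 0)
      - (if i = k ∧ j = 2 then 1 else 0)) / p 2 := by
  have hz : p 2 ≠ 0 := ne_of_gt hp
  simp only [christoffel, inv_metric hp, dMetric_eq hp, Matrix.smul_apply, Matrix.one_apply,
    smul_eq_mul, mul_ite, mul_one, mul_zero, ite_mul, zero_mul, Finset.sum_ite_eq,
    Finset.mem_univ, if_true]
  split_ifs <;> field_simp <;> ring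

lemma covDeriv_zero {c V : ℝ → Vec} {t : ℝ} (hc : c t ∈ halfSpace) :
    covDeriv c V t 0 =
      deriv V t 0 - (deriv c t 0 * V t 2 + deriv c t 2 * V t 0) / c t 2 := by
  simp [covDeriv, christoffel_eq hc, Fin.sum_univ_three]
  ring

lemma covDeriv_one {c V : ℝ → Vec} {t : ℝ} (hc : c t ∈ halfSpace) :
    covDeriv c V t 1 =
      deriv V t 1 - (deriv c t 1 * V t 2 + deriv c t 2 * V t 1) / c t 2 := by
  simp [covDeriv, christoffel_eq hc, Fin.sum_univ_three]
  ring

lemma covDeriv_two {c V : ℝ → Vec} {t : ℝ} (hc : c t ∈ halfSpace) :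
    covDeriv c V t 2 = deriv V t 2 +
      (deriv c t 0 * V t 0 + deriv c t 1 * V t 1 - deriv c t 2 * V t 2) / c t 2 := by
  simp [covDeriv, christoffel_eq hc, Fin.sum_univ_three]
  ring

/-- A vector field whose covariant derivative is tangent to the curve is parallel with respect to
the normal connection. -/
lemma normalCovDeriv_eq_zero {c V : ℝ → Vec} {t k : ℝ} (hc : c t ∈ halfSpace)
    (hc' : deriv c t ≠ 0) (h : covDeriv c V t = k • deriv c t) : normalCovDeriv c V t = 0 := by
  rw [normalCovDeriv, h, g_smul_left, mul_div_cancel_right₀ _ (g_self_pos hc hc').ne', sub_self]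

/-! ### The Lorentz form -/

/-- The Lorentz form on `ℝ⁴` in light-cone coordinates: the coordinates `0` and `3` are null. -/
noncomputable def lorentz (X Y : Fin 4 → ℝ) : ℝ := X 1 * Y 1 + X 2 * Y 2 - (X 0 * Y 3 + X 3 * Y 0) / 2

lemma lorentz_comm (X Y : Fin 4 → ℝ) : lorentz X Y = lorentz Y X := by
  simp only [lorentz]
  ring

lemma lorentz_add_left (X Y Z : Fin 4 → ℝ) :
    lorentz (X + Y) Z = lorentz X Z + lorentz Y Z := by
  simp only [lorentz, Pi.add_apply]
  ring

lemma lorentz_smul_left (k : ℝ) (X Y : Fin 4 → ℝ) : lorentz (k • X) Y = k * lorentz X Y := by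
  simp only [lorentz, Pi.smul_apply, smul_eq_mul]
  ring

lemma lorentz_add_right (X Y Z : Fin 4 → ℝ) :
    lorentz X (Y + Z) = lorentz X Y + lorentz X Z := by
  simp only [lorentz, Pi.add_apply]
  ring

lemma lorentz_smul_right (k : ℝ) (X Y : Fin 4 → ℝ) : lorentz X (k • Y) = k * lorentz X Y := by
  simp only [lorentz, Pi.smul_apply, smul_eq_mul]
  ring

lemma hasDerivAt_lorentz {X Y : ℝ → Fin 4 → ℝ} {X' Y' : Fin 4 → ℝ} {t : ℝ}
    (hX : HasDerivAt X X' t) (hY : HasDerivAt Y Y' t) :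
    HasDerivAt (fun s => lorentz (X s) (Y s)) (lorentz X' (Y t) + lorentz (X t) Y') t := by
  rw [hasDerivAt_pi] at hX hY
  refine ((((hX 1).mul (hY 1)).add ((hX 2).mul (hY 2))).sub
    ((((hX 0).mul (hY 3)).add ((hX 3).mul (hY 0))).div_const 2)).congr_deriv ?_
  simp only [lorentz]
  ring

lemma contDiffOn_lorentz {X Y : ℝ → Fin 4 → ℝ} {I : Set ℝ} (hX : ContDiffOn ℝ ∞ X I)
    (hY : ContDiffOn ℝ ∞ Y I) : ContDiffOn ℝ ∞ (fun s => lorentz (X s) (Y s)) I := by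
  rw [contDiffOn_pi] at hX hY
  exact (((hX 1).mul (hY 1)).add ((hX 2).mul (hY 2))).sub
    ((((hX 0).mul (hY 3)).add ((hX 3).mul (hY 0))).div_const 2)

/-! ### The hyperboloid model -/

/-- The isometry from the half-space onto a sheet of the hyperboloid `lorentz X X = -1`. -/
noncomputable def toHyperboloid (p : Vec) : Fin 4 → ℝ :=
  ![1 / p 2, p 0 / p 2, p 1 / p 2, (p 0 ^ 2 + p 1 ^ 2 + p 2 ^ 2) / p 2]

/-- The differential of `toHyperboloid` at `p`, applied to the tangent vector `v`. -/
noncomputable def dToHyperboloid (p v : Vec) : Fin 4 → ℝ :=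
  ![-v 2 / p 2 ^ 2, (v 0 * p 2 - p 0 * v 2) / p 2 ^ 2, (v 1 * p 2 - p 1 * v 2) / p 2 ^ 2,
    ((2 * p 0 * v 0 + 2 * p 1 * v 1 + 2 * p 2 * v 2) * p 2
      - (p 0 ^ 2 + p 1 ^ 2 + p 2 ^ 2) * v 2) / p 2 ^ 2]

lemma dToHyperboloid_smul (p v : Vec) (k : ℝ) :
    dToHyperboloid p (k • v) = k • dToHyperboloid p v := by
  funext i
  fin_cases i <;> simp [dToHyperboloid] <;> ring

lemma lorentz_toHyperboloid {p : Vec} (hp : p ∈ halfSpace) :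
    lorentz (toHyperboloid p) (toHyperboloid p) = -1 := by
  have hz : p 2 ≠ 0 := ne_of_gt hp
  simp [lorentz, toHyperboloid]
  field_simp
  ring

lemma lorentz_toHyperboloid_dToHyperboloid {p : Vec} (hp : p ∈ halfSpace) (v : Vec) :
    lorentz (toHyperboloid p) (dToHyperboloid p v) = 0 := by
  have hz : p 2 ≠ 0 := ne_of_gt hp
  simp [lorentz, toHyperboloid, dToHyperboloid]
  field_simp
  ring

lemma lorentz_dToHyperboloid {p : Vec} (hp : p ∈ halfSpace) (u v : Vec) :
    lorentz (dToHyperboloid p u) (dToHyperboloid p v) = g p u v := by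
  have hz : p 2 ≠ 0 := ne_of_gt hp
  simp [lorentz, dToHyperboloid, g_eq]
  field_simp
  ring

/-- A left inverse of `dToHyperboloid p`. -/
noncomputable def fromHyperboloid (p : Vec) (M : Fin 4 → ℝ) : Vec :=
  ![p 2 * (M 1 - p 0 * M 0), p 2 * (M 2 - p 1 * M 0), -p 2 ^ 2 * M 0]

lemma fromHyperboloid_dToHyperboloid {p : Vec} (hp : p ∈ halfSpace) (v : Vec) :
    fromHyperboloid p (dToHyperboloid p v) = v := by
  have hz : p 2 ≠ 0 := ne_of_gt hp
  funext i
  fin_cases i <;> simp [fromHyperboloid, dToHyperboloid] <;> field_simp <;> ring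

lemma dToHyperboloid_injective {p : Vec} (hp : p ∈ halfSpace) :
    Function.Injective (dToHyperboloid p) :=
  Function.LeftInverse.injective (fromHyperboloid_dToHyperboloid hp)

lemma contDiffOn_fromHyperboloid {c : ℝ → Vec} {M : ℝ → Fin 4 → ℝ} {I : Set ℝ}
    (hc : ContDiffOn ℝ ∞ c I) (hM : ContDiffOn ℝ ∞ M I) :
    ContDiffOn ℝ ∞ (fun s => fromHyperboloid (c s) (M s)) I := by
  rw [contDiffOn_pi] at hc hM
  refine contDiffOn_pi.2 fun i => ?_
  fin_cases i
  · exact (hc 2).mul ((hM 1).sub ((hc 0).mul (hM 0)))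
  · exact (hc 2).mul ((hM 2).sub ((hc 1).mul (hM 0)))
  · exact ((hc 2).pow 2).neg.mul (hM 0)

lemma contDiffOn_toHyperboloid {c : ℝ → Vec} {I : Set ℝ} (hc : ContDiffOn ℝ ∞ c I)
    (hmem : ∀ s ∈ I, c s ∈ halfSpace) :
    ContDiffOn ℝ ∞ (fun s => toHyperboloid (c s)) I := by
  have hz : ∀ s ∈ I, c s 2 ≠ 0 := fun s hs => ne_of_gt (hmem s hs)
  rw [contDiffOn_pi] at hc
  refine contDiffOn_pi.2 fun i => ?_
  fin_cases i
  · exact contDiffOn_const.div (hc 2) hz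
  · exact (hc 0).div (hc 2) hz
  · exact (hc 1).div (hc 2) hz
  · exact ((((hc 0).pow 2).add ((hc 1).pow 2)).add ((hc 2).pow 2)).div (hc 2) hz

lemma hasDerivAt_toHyperboloid {c : ℝ → Vec} {t : ℝ} (hc : DifferentiableAt ℝ c t)
    (hmem : c t ∈ halfSpace) :
    HasDerivAt (fun s => toHyperboloid (c s)) (dToHyperboloid (c t) (deriv c t)) t := by
  have hz : c t 2 ≠ 0 := ne_of_gt hmem
  have h := hasDerivAt_pi.1 hc.hasDerivAt
  refine hasDerivAt_pi.2 fun i => ?_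
  fin_cases i
  · refine ((hasDerivAt_const t (1 : ℝ)).div (h 2) hz).congr_deriv ?_
    simp [dToHyperboloid]
  · exact (h 0).div (h 2) hz
  · exact (h 1).div (h 2) hz
  · refine (((((h 0).pow 2).add ((h 1).pow 2)).add ((h 2).pow 2)).div (h 2) hz).congr_deriv ?_
    simp [dToHyperboloid]

/-- The Gauss formula of the hyperboloid: the derivative of a tangent field is its covariant
derivative plus a multiple of the position vector. -/
lemma hasDerivAt_dToHyperboloid {c V : ℝ → Vec} {t : ℝ} (hc : DifferentiableAt ℝ c t)
    (hV : DifferentiableAt ℝ V t) (hmem : c t ∈ halfSpace) :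
    HasDerivAt (fun s => dToHyperboloid (c s) (V s))
      (dToHyperboloid (c t) (covDeriv c V t) + g (c t) (deriv c t) (V t) • toHyperboloid (c t))
      t := by
  have hz : c t 2 ≠ 0 := ne_of_gt hmem
  have hz2 : c t 2 ^ 2 ≠ 0 := pow_ne_zero 2 hz
  have h := hasDerivAt_pi.1 hc.hasDerivAt
  have k := hasDerivAt_pi.1 hV.hasDerivAt
  refine hasDerivAt_pi.2 fun i => ?_
  fin_cases i
  · refine ((k 2).neg.div ((h 2).pow 2) hz2).congr_deriv ?_
    simp [dToHyperboloid, toHyperboloid, g_eq, covDeriv_two hmem]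
    field_simp
    ring
  · refine ((((k 0).mul (h 2)).sub ((h 0).mul (k 2))).div ((h 2).pow 2) hz2).congr_deriv ?_
    simp [dToHyperboloid, toHyperboloid, g_eq, covDeriv_two hmem, covDeriv_zero hmem]
    field_simp
    ring
  · refine ((((k 1).mul (h 2)).sub ((h 1).mul (k 2))).div ((h 2).pow 2) hz2).congr_deriv ?_
    simp [dToHyperboloid, toHyperboloid, g_eq, covDeriv_two hmem, covDeriv_one hmem]
    field_simp
    ring
  · refine ((((((((h 0).const_mul 2).mul (k 0)).add (((h 1).const_mul 2).mul (k 1))).add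
      (((h 2).const_mul 2).mul (k 2))).mul (h 2)).sub
      (((((h 0).pow 2).add ((h 1).pow 2)).add ((h 2).pow 2)).mul (k 2))).div
      ((h 2).pow 2) hz2).congr_deriv ?_
    simp [dToHyperboloid, toHyperboloid, g_eq, covDeriv_two hmem, covDeriv_one hmem,
      covDeriv_zero hmem]
    field_simp
    ring

/-! ### Geodesics -/

/-- The solution of the linear system `X' = Y`, `Y' = X`. -/
lemma eq_cosh_sinh {X Y : ℝ → Fin 4 → ℝ} (hX : ∀ t, HasDerivAt X (Y t) t)
    (hY : ∀ t, HasDerivAt Y (X t) t) (t : ℝ) :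
    X t = Real.cosh t • X 0 + Real.sinh t • Y 0 ∧
      Y t = Real.sinh t • X 0 + Real.cosh t • Y 0 := by
  have h1 : ∀ t, HasDerivAt (fun t => Real.cosh t • X t - Real.sinh t • Y t) 0 t := fun t => by
    refine (((Real.hasDerivAt_cosh t).smul (hX t)).sub
      ((Real.hasDerivAt_sinh t).smul (hY t))).congr_deriv ?_
    abel
  have h2 : ∀ t, HasDerivAt (fun t => Real.cosh t • Y t - Real.sinh t • X t) 0 t := fun t => by
    refine (((Real.hasDerivAt_cosh t).smul (hY t)).sub
      ((Real.hasDerivAt_sinh t).smul (hX t))).congr_deriv ?_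
    abel
  have e1 := is_const_of_deriv_eq_zero (fun t => (h1 t).differentiableAt)
    (fun t => (h1 t).deriv) t 0
  have e2 := is_const_of_deriv_eq_zero (fun t => (h2 t).differentiableAt)
    (fun t => (h2 t).deriv) t 0
  simp only [Real.cosh_zero, Real.sinh_zero, one_smul, zero_smul, sub_zero] at e1 e2
  have hcs := Real.cosh_sq t
  constructor <;> rw [← e1, ← e2] <;> funext i <;>
    simp only [Pi.add_apply, Pi.sub_apply, Pi.smul_apply, smul_eq_mul]
  · linear_combination (-X t i) * hcs
  · linear_combination (-Y t i) * hcs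

/-- A unit speed geodesic and its velocity in the hyperboloid model. -/
lemma IsGeodesic.toHyperboloid_eq {γ : ℝ → Vec} (hγ : IsGeodesic γ)
    (h1 : g (γ 0) (deriv γ 0) (deriv γ 0) = 1) (t : ℝ) :
    toHyperboloid (γ t) = Real.cosh t • toHyperboloid (γ 0) +
        Real.sinh t • dToHyperboloid (γ 0) (deriv γ 0) ∧
      dToHyperboloid (γ t) (deriv γ t) = Real.sinh t • toHyperboloid (γ 0) +
        Real.cosh t • dToHyperboloid (γ 0) (deriv γ 0) := by
  have hd : Differentiable ℝ γ := hγ.smooth.differentiable (by simp)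
  have hd' : Differentiable ℝ (deriv γ) :=
    ((contDiff_infty_iff_deriv.1 hγ.smooth).2).differentiable (by simp)
  have hY : ∀ t, HasDerivAt (fun t => dToHyperboloid (γ t) (deriv γ t))
      (g (γ t) (deriv γ t) (deriv γ t) • toHyperboloid (γ t)) t := fun t => by
    refine (hasDerivAt_dToHyperboloid (hd t) (hd' t) (hγ.mem t)).congr_deriv ?_
    have h0 : dToHyperboloid (γ t) 0 = 0 := by
      simpa using dToHyperboloid_smul (γ t) 0 0
    rw [hγ.eq_zero t, h0, zero_add]
  -- The speed is constant, because the acceleration is a multiple of the position vector.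
  have hq : ∀ t, HasDerivAt (fun t => g (γ t) (deriv γ t) (deriv γ t)) 0 t := fun t => by
    have h := hasDerivAt_lorentz (hY t) (hY t)
    simp only [lorentz_dToHyperboloid (hγ.mem _)] at h
    refine h.congr_deriv ?_
    rw [lorentz_smul_right, lorentz_comm, lorentz_smul_right,
      lorentz_comm, lorentz_toHyperboloid_dToHyperboloid (hγ.mem t)]
    ring
  have hs : ∀ t, g (γ t) (deriv γ t) (deriv γ t) = 1 := fun t => by
    rw [← h1]
    exact is_const_of_deriv_eq_zero (fun t => (hq t).differentiableAt)
      (fun t => (hq t).deriv) t 0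
  refine eq_cosh_sinh (fun t => hasDerivAt_toHyperboloid (hd t) (hγ.mem t)) (fun t => ?_) t
  simpa only [hs, one_smul] using hY t

/-! ### Involutes on the hyperboloid -/

lemma g_unitTangent {c : ℝ → Vec} {s : ℝ} (hc : c s ∈ halfSpace) (hc' : deriv c s ≠ 0) :
    g (c s) (unitTangent c s) (unitTangent c s) = 1 := by
  have hpos := g_self_pos hc hc'
  have hsq := Real.sq_sqrt hpos.le
  have hne := (Real.sqrt_pos.2 hpos).ne'
  rw [← lorentz_dToHyperboloid hc, unitTangent, dToHyperboloid_smul, lorentz_smul_left,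
    lorentz_smul_right, lorentz_dToHyperboloid hc]
  field_simp
  exact hsq.symm

lemma deriv_eq_smul_unitTangent {c : ℝ → Vec} {s : ℝ} (hc : c s ∈ halfSpace)
    (hc' : deriv c s ≠ 0) :
    deriv c s = Real.sqrt (g (c s) (deriv c s) (deriv c s)) • unitTangent c s := by
  have hne := (Real.sqrt_pos.2 (g_self_pos hc hc')).ne'
  rw [unitTangent, smul_smul, mul_one_div_cancel hne, one_smul]

lemma contDiffOn_dToHyperboloid_unitTangent {c : ℝ → Vec} {I : Set ℝ} (hI : IsOpen I)
    (hc : IsImmersedCurve I c) :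
    ContDiffOn ℝ ∞ (fun s => dToHyperboloid (c s) (unitTangent c s)) I := by
  have hd : ContDiffOn ℝ ∞ (fun s => dToHyperboloid (c s) (deriv c s)) I := by
    refine ((contDiffOn_toHyperboloid hc.smooth hc.mem).deriv_of_isOpen (m := ∞) hI
      (by simp)).congr fun s hs => ?_
    exact (hasDerivAt_toHyperboloid ((hc.smooth.contDiffAt (hI.mem_nhds hs)).differentiableAt
      (by simp)) (hc.mem s hs)).deriv.symm
  have hg : ContDiffOn ℝ ∞ (fun s => g (c s) (deriv c s) (deriv c s)) I :=
    (contDiffOn_lorentz hd hd).congr fun s hs => (lorentz_dToHyperboloid (hc.mem s hs) _ _).symm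
  have hpos : ∀ s ∈ I, 0 < g (c s) (deriv c s) (deriv c s) := fun s hs =>
    g_self_pos (hc.mem s hs) (hc.deriv_ne_zero s hs)
  refine ((contDiffOn_const (c := (1 : ℝ))).div (hg.sqrt fun s hs => (hpos s hs).ne')
    fun s hs => (Real.sqrt_pos.2 (hpos s hs)).ne').smul hd |>.congr fun s hs => ?_
  rw [unitTangent, dToHyperboloid_smul]
  rfl

/-- The infinitesimal form of the theorem on the hyperboloid. Here `A` is a curve with unit tangent
`U` and speed `a`, `B = cosh l A + sinh l U` lies on its tangential surface, and
`M = sinh l A + cosh l U` is the velocity of the tangent geodesic. If `M` is orthogonal to `B'`, then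
`M'` and `B'` are proportional, with ratio `cosh l : sinh l`. -/
lemma sinh_smul_deriv_eq {A U : ℝ → Fin 4 → ℝ} {l : ℝ → ℝ} {s a l' : ℝ} {U' : Fin 4 → ℝ}
    {B' M' : Fin 4 → ℝ}
    (hA : HasDerivAt A (a • U s) s) (hU : HasDerivAt U U' s) (hl : HasDerivAt l l' s)
    (hAA : lorentz (A s) (A s) = -1) (hUU : lorentz (U s) (U s) = 1)
    (hAU : lorentz (A s) (U s) = 0)
    (hAU' : lorentz (A s) U' = -a) (hUU' : lorentz (U s) U' = 0)
    (hB : HasDerivAt (fun t => Real.cosh (l t) • A t + Real.sinh (l t) • U t) B' s)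
    (hM : HasDerivAt (fun t => Real.sinh (l t) • A t + Real.cosh (l t) • U t) M' s)
    (horth : lorentz B' (Real.sinh (l s) • A s + Real.cosh (l s) • U s) = 0) :
    Real.sinh (l s) • M' = Real.cosh (l s) • B' := by
  have eB := hB.unique ((hl.cosh.smul hA).add (hl.sinh.smul hU))
  have eM := hM.unique ((hl.sinh.smul hA).add (hl.cosh.smul hU))
  have hcs := Real.cosh_sq (l s)
  have hla : l' = -a := by
    rw [eB] at horth
    simp only [lorentz_add_left, lorentz_add_right, lorentz_smul_left, lorentz_smul_right,
      hAA, hUU, hAU, lorentz_comm U', lorentz_comm (U s) (A s), hAU', hUU'] at horth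
    have e : (l' + a) * (Real.cosh (l s) ^ 2 - Real.sinh (l s) ^ 2) = 0 := by
      linear_combination horth
    rw [hcs] at e
    linarith
  rw [eB, eM, hla]
  funext i
  simp only [Pi.add_apply, Pi.smul_apply, smul_eq_mul]
  ring

end Hyp3

open Hyp3

theorem mainTheorem2 (I : Set ℝ) (hI : IsOpen I) (hI' : I.OrdConnected)
    (α β : ℝ → Hyp3.Vec)
    (hα : Hyp3.IsImmersedCurve I α) (hβ : Hyp3.IsImmersedCurve I β)
    (γ : ℝ → ℝ → Hyp3.Vec) (hγ : Hyp3.IsTangentialSurface I α γ)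
    (lam : ℝ → ℝ) (hinv : Hyp3.IsInvolute I γ lam β) :
    Hyp3.IsRM I β (fun s => deriv (γ s) (lam s)) := by
  set N : ℝ → Vec := fun s => deriv (γ s) (lam s) with hN
  set A : ℝ → Fin 4 → ℝ := fun s => toHyperboloid (α s) with hA
  set U : ℝ → Fin 4 → ℝ := fun s => dToHyperboloid (α s) (unitTangent α s) with hU
  have sA : ContDiffOn ℝ ∞ A I := contDiffOn_toHyperboloid hα.smooth hα.mem
  have sU : ContDiffOn ℝ ∞ U I := contDiffOn_dToHyperboloid_unitTangent hI hα
  have hAA : ∀ s ∈ I, lorentz (A s) (A s) = -1 := fun s hs => lorentz_toHyperboloid (hα.mem s hs)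
  have hAU : ∀ s ∈ I, lorentz (A s) (U s) = 0 := fun s hs =>
    lorentz_toHyperboloid_dToHyperboloid (hα.mem s hs) _
  have hUU : ∀ s ∈ I, lorentz (U s) (U s) = 1 := fun s hs => by
    rw [← g_unitTangent (hα.mem s hs) (hα.deriv_ne_zero s hs)]
    exact lorentz_dToHyperboloid (hα.mem s hs) _ _
  have hgeo : ∀ s ∈ I,
      toHyperboloid (β s) = Real.cosh (lam s) • A s + Real.sinh (lam s) • U s ∧
      dToHyperboloid (β s) (N s) = Real.sinh (lam s) • A s + Real.cosh (lam s) • U s := by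
    intro s hs
    have h := (hγ.geodesic s hs).toHyperboloid_eq (by
      rw [hγ.apply_zero s hs, hγ.deriv_zero s hs]
      exact g_unitTangent (hα.mem s hs) (hα.deriv_ne_zero s hs)) (lam s)
    rwa [hγ.apply_zero s hs, hγ.deriv_zero s hs, ← hinv.eq s hs] at h
  -- The parameter is recovered from `sinh λ = ⟪B, U⟫`, which makes it smooth.
  have slam : ContDiffOn ℝ ∞ lam I := by
    refine (Real.contDiff_arsinh.comp_contDiffOn
      (contDiffOn_lorentz (contDiffOn_toHyperboloid hβ.smooth hβ.mem) sU)).congr fun s hs => ?_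
    simp [(hgeo s hs).1, lorentz_add_left, lorentz_smul_left, hAU s hs, hUU s hs]
  have sN : ContDiffOn ℝ ∞ N I := by
    have sM : ContDiffOn ℝ ∞
        (fun s => Real.sinh (lam s) • A s + Real.cosh (lam s) • U s) I :=
      (slam.sinh.smul sA).add (slam.cosh.smul sU)
    refine (contDiffOn_fromHyperboloid hβ.smooth sM).congr fun s hs => ?_
    rw [← (hgeo s hs).2, fromHyperboloid_dToHyperboloid (hβ.mem s hs)]
  refine ⟨sN, hinv.orthogonal, fun s hs => ?_⟩
  have hnhds := hI.mem_nhds hs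
  have diff {E : Type} [NormedAddCommGroup E] [NormedSpace ℝ E] {f : ℝ → E}
      (hf : ContDiffOn ℝ ∞ f I) : DifferentiableAt ℝ f s :=
    (hf.contDiffAt hnhds).differentiableAt (by simp)
  have dA := hasDerivAt_toHyperboloid (diff hα.smooth) (hα.mem s hs)
  rw [deriv_eq_smul_unitTangent (hα.mem s hs) (hα.deriv_ne_zero s hs), dToHyperboloid_smul] at dA
  have dU := (diff sU).hasDerivAt
  have hUU' : lorentz (U s) (deriv U s) = 0 := by
    have h := (hasDerivAt_lorentz dU dU).unique ((hasDerivAt_const s (1 : ℝ)).congr_of_eventuallyEq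
      (Filter.eventually_of_mem hnhds hUU))
    rw [lorentz_comm (deriv U s)] at h
    linarith
  have hAU' := (hasDerivAt_lorentz dA dU).unique
    ((hasDerivAt_const s (0 : ℝ)).congr_of_eventuallyEq (Filter.eventually_of_mem hnhds hAU))
  rw [lorentz_smul_left] at hAU'
  have dB := (hasDerivAt_toHyperboloid (diff hβ.smooth) (hβ.mem s hs)).congr_of_eventuallyEq
    (Filter.eventually_of_mem hnhds fun t ht => ((hgeo t ht).1).symm)
  have dM := (hasDerivAt_dToHyperboloid (diff hβ.smooth) (diff sN)
    (hβ.mem s hs)).congr_of_eventuallyEq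
    (Filter.eventually_of_mem hnhds fun t ht => ((hgeo t ht).2).symm)
  rw [show g (β s) (deriv β s) (N s) = 0 from hinv.orthogonal s hs, zero_smul, add_zero] at dM
  have key := sinh_smul_deriv_eq dA dU (diff slam).hasDerivAt (hAA s hs) (hUU s hs) (hAU s hs)
    (by linear_combination hAU' - Real.sqrt (g (α s) (deriv α s) (deriv α s)) * hUU s hs)
    hUU' dB dM (by
      rw [← (hgeo s hs).2, lorentz_dToHyperboloid (hβ.mem s hs)]
      exact hinv.orthogonal s hs)
  rw [← dToHyperboloid_smul, ← dToHyperboloid_smul] at key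
  have key' := dToHyperboloid_injective (hβ.mem s hs) key
  -- On the edge of regression `sinh λ = 0`, the involute would be singular.
  have hsinh : Real.sinh (lam s) ≠ 0 := fun h0 => by
    rw [h0, zero_smul, eq_comm, smul_eq_zero] at key'
    exact key'.elim (Real.cosh_pos _).ne' (hβ.deriv_ne_zero s hs)
  refine normalCovDeriv_eq_zero (k := (Real.sinh (lam s))⁻¹ * Real.cosh (lam s))
    (hβ.mem s hs) (hβ.deriv_ne_zero s hs) ?_
  rw [mul_smul, ← key', inv_smul_smul₀ hsinh]
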